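/- Let $\theta>0$, let $L\ge 2$ be an integer, and for each $n$ let $J_n\subset\{1,\dots,n\}$ be arbitrary. For a permutation $\sigma$ of $n$ elements let $k_j(\sigma)$ be its number of cycles of length $j$ (fixed points counted as cycles of length $1$), let $w(\sigma)=\sum_{j\le n}k_j(\sigma)$ and $w(\sigma,J_n)=\sum_{j\in J_n}k_j(\sigma)$, and let $\nu_n(A)=\frac{1}{\theta^{(n)}}\sum_{\sigma\in A}\theta^{w(\sigma)}$, where $\theta^{(n)}=\theta(\theta+1)\cdots(\theta+n-1)$, be the Ewens probability measure on the symmetric group $\mathbf S_n$. Put $V_n(x)=\nu_n\big(w(\sigma,J_n)<x\big)$. Let $Y$ be a random variable taking values in $\{0,1,\dots,L-1\}$, with distribution function $F_Y(x)=P(Y<x)$, and let $\upsilon(l)=\mathbf E\,Y(Y-1)\cdots(Y-l+1)$ for $1\le l\le L-1$. Consider the conditions $$\lim_{n\to\infty}\theta^l\sum_{\substack{j_1,\dots,j_l\in J_n\\ n/L<j_1,\dots,j_l<n}}\frac{\mathbf 1\{j_1+\cdots+j_l<n\}}{j_1\cdots j_l}\Big(1-\frac{j_1+\cdots+j_l}{n}\Big)^{\theta-1}=\upsilon(l)\qquad\text{for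 each } 1\le l\le L-1 \tag{1}$$ and $$\lim_{n\to\infty}\sum_{j\in J_n,\ j\le n/L}\frac1j=0. \tag{2}$$ If (1) and (2) hold, then $V_n$ converges weakly to $F_Y$ as $n\to\infty$ (that is, $V_n(x)\to F_Y(x)$ at every continuity point $x$ of $F_Y$). Conversely, if $\theta\le 1$ and $V_n$ converges weakly to $F_Y$, then (1) and (2) hold. -/

import Mathlib

open Filter Topology MeasureTheory

noncomputable section

namespace Ewens

/-- `k_j(σ)`: the number of cycles of length `j` in the cycle decomposition of `σ`
(fixed points are counted as cycles of length `1`; `σ.partition` is the partition of `n`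
into cycle lengths). -/
def cycleCount {n : ℕ} (σ : Equiv.Perm (Fin n)) (j : ℕ) : ℕ :=
  σ.partition.parts.count j

/-- `w(σ)`: the total number of cycles of `σ`, fixed points included. -/
def numCycles {n : ℕ} (σ : Equiv.Perm (Fin n)) : ℕ :=
  ∑ j ∈ Finset.Icc 1 n, cycleCount σ j

/-- `w(σ, J)`: the number of cycles of `σ` with lengths in `J`. -/
def numCyclesIn {n : ℕ} (σ : Equiv.Perm (Fin n)) (J : Finset ℕ) : ℕ :=
  ∑ j ∈ J, cycleCount σ j

/-- The rising factorial `θ^{(n)} = θ (θ + 1) ⋯ (θ + n - 1)`. -/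
def risingFactorial (θ : ℝ) (n : ℕ) : ℝ :=
  ∏ i ∈ Finset.range n, (θ + (i : ℝ))

/-- The Ewens probability `ν_{n,θ}(A) = (1 / θ^{(n)}) ∑_{σ ∈ A} θ^{w(σ)}` of a set `A` of
permutations of `n` elements. -/
def ewensProb (θ : ℝ) (n : ℕ) (A : Set (Equiv.Perm (Fin n))) : ℝ :=
  1 / risingFactorial θ n * ∑ σ : Equiv.Perm (Fin n), A.indicator (fun σ => θ ^ numCycles σ) σ

/-- `V_n(x) = ν_{n,θ}(w(σ, J) < x)`: the distribution function of `w(σ, J)` under the Ewens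
probability. -/
def cycleDF (θ : ℝ) (n : ℕ) (J : Finset ℕ) (x : ℝ) : ℝ :=
  ewensProb θ n {σ | (numCyclesIn σ J : ℝ) < x}

/-- `F_Y(x) = P(Y < x)`: the distribution function of a random variable with values in `ℕ`. -/
def distFun {Ω : Type*} [MeasurableSpace Ω] (P : Measure Ω) (Y : Ω → ℕ) (x : ℝ) : ℝ :=
  P.real {ω | (Y ω : ℝ) < x}

/-- Weak convergence `F_n ⇒ G` of distribution functions: pointwise convergence at every
continuity point of the limit `G`. -/
def WeakConv (F : ℕ → ℝ → ℝ) (G : ℝ → ℝ) : Prop :=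
  ∀ x : ℝ, ContinuousAt G x → Tendsto (fun n => F n x) atTop (𝓝 (G x))

/-- `θ^l ∑ 1{j_1 + ⋯ + j_l < n} / (j_1 ⋯ j_l) * (1 - (j_1 + ⋯ + j_l) / n) ^ (θ - 1)`, the sum
running over all `l`-tuples of elements `j_i` of `J` with `n / L < j_i < n`. -/
def longCycleMoment (θ : ℝ) (L n : ℕ) (J : Finset ℕ) (l : ℕ) : ℝ :=
  θ ^ l * ∑ j ∈ Fintype.piFinset
      (fun _ : Fin l => J.filter (fun i : ℕ => (n : ℝ) / (L : ℝ) < (i : ℝ) ∧ i < n)),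
    if ∑ i, j i < n then
      1 / (∏ i, (j i : ℝ)) * (1 - (∑ i, (j i : ℝ)) / (n : ℝ)) ^ (θ - 1)
    else 0

/-- `∑ 1 / j` over the elements `j ≤ n / L` of `J`. -/
def shortCycleWeight (L n : ℕ) (J : Finset ℕ) : ℝ :=
  ∑ j ∈ J.filter (fun i : ℕ => (i : ℝ) ≤ (n : ℝ) / (L : ℝ)), 1 / (j : ℝ)

end Ewens

end

/-! Write p(n) = θ^{(n)}/n! (`ewensMass`). Marking a cycle of length j and removing it gives E_n[k_j
f] = (θ/j) E_{n-j}[f with a cycle j added] for unnormalised expectations. Iterating, the l-th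
factorial moment of the number of cycles with lengths in S is θ^l times the l-fold convolution of
1/j on S with p (`ewensSum_descFactorial`).

Long cycles, n/L < j < n: here 1/j < L/n, so replacing p(i)/p(n) by (i/n)^(θ-1) costs at most a
constant times the mean error of this approximation, which tends to 0 (`tendsto_massError`). Hence
the factorial moments always differ by o(1) from the sums in (1). A permutation has fewer than L
long cycles, so finitely many factorial moments and the distribution function determine each other
linearly, which makes (1) equivalent to weak convergence for the long cycles alone.

Under (2), short cycles and the n-cycle are absent with probability tending to 1, so they do not
affect the limit. It remains to derive (2) from weak convergence when θ ≤ 1. Let u be θ times the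
sum in (2) and w the number of short cycles. Since p decreases, the L-th factorial moment of w is at
least u^L; the next one is at most (u+1) times the L-th. Truncation then gives u^L ≤ 2(2u+L+2)^L P(w
≥ L) (`pow_le_tail`), and P(w ≥ L) tends to 0 because Y < L almost surely. -/

open scoped Nat

namespace Ewens

/-! ### Counting permutations by cycle type -/

/-- The parts that are at least `2` together with the parts equal to `1` are all the parts. -/
theorem filter_two_le_add_replicate {m : Multiset ℕ} (hm : ∀ x ∈ m, 0 < x) :
    m.filter (2 ≤ ·) + Multiset.replicate (m.count 1) 1 = m := by
  conv_rhs => rw [← Multiset.filter_add_not (2 ≤ ·) m]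
  congr 1
  rw [← Multiset.filter_eq']
  refine Multiset.filter_congr fun x hx => ?_
  have := hm x hx
  omega

theorem prod_factorial_count_subset {m : Multiset ℕ} {S : Finset ℕ} (h : m.toFinset ⊆ S) :
    ∏ j ∈ m.toFinset, (m.count j)! = ∏ j ∈ S, (m.count j)! := by
  refine Finset.prod_subset h fun x _ hx => ?_
  rw [Multiset.mem_toFinset] at hx
  simp [Multiset.count_eq_zero_of_notMem hx]

/-- The number of permutations with a given partition into cycle lengths. -/
theorem card_partition_eq_mul {α : Type*} [Fintype α] [DecidableEq α]
    (l : (Fintype.card α).Partition) :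
    (Finset.univ.filter fun σ : Equiv.Perm α => σ.partition = l).card *
      (l.parts.prod * ∏ j ∈ l.parts.toFinset, (l.parts.count j)!) = (Fintype.card α)! := by
  set m := l.parts.filter (2 ≤ ·) with hm
  have hpos : ∀ x ∈ l.parts, 0 < x := fun x hx => l.parts_pos hx
  have hl := filter_two_le_add_replicate hpos
  have hsum : m.sum + l.parts.count 1 = Fintype.card α := by
    have := congrArg Multiset.sum hl
    simpa [l.parts_sum] using this
  have hset : (Finset.univ.filter fun σ : Equiv.Perm α => σ.partition = l) =
      Finset.univ.filter fun σ : Equiv.Perm α => σ.cycleType = m := by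
    ext σ
    simp only [Finset.mem_filter, Finset.mem_univ, true_and]
    constructor
    · rintro rfl
      exact (Equiv.Perm.filter_parts_partition_eq_cycleType).symm
    · intro h
      ext1
      rw [Equiv.Perm.parts_partition, ← Equiv.Perm.sum_cycleType, h]
      conv_rhs => rw [← hl]
      congr 2
      omega
  have hprod : m.prod = l.parts.prod := by
    have := congrArg Multiset.prod hl
    simpa using this
  have hcount : ∀ j, j ≠ 1 → m.count j = l.parts.count j := by
    intro j hj
    conv_rhs => rw [← hl, Multiset.count_add, Multiset.count_replicate]
    rw [if_neg (Ne.symm hj), add_zero]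
  have h1 : m.count 1 = 0 := Multiset.count_eq_zero_of_notMem (by simp [hm])
  -- `Fintype.card α - m.sum` is the number of fixed points. Both products are extended to a common
  -- index set containing 1, where the factor at 1 splits off.
  have hfac : ∏ j ∈ l.parts.toFinset, (l.parts.count j)! =
      (Fintype.card α - m.sum)! * ∏ j ∈ m.toFinset, (m.count j)! := by
    rw [prod_factorial_count_subset (Finset.subset_insert 1 l.parts.toFinset),
      prod_factorial_count_subset (S := insert 1 l.parts.toFinset) (m := m)
        (((Multiset.toFinset_subset.2 (Multiset.filter_subset _ _))).trans
          (Finset.subset_insert _ _)),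
      ← Finset.mul_prod_erase _ _ (Finset.mem_insert_self 1 l.parts.toFinset),
      ← Finset.mul_prod_erase _ (fun j => (m.count j)!)
        (Finset.mem_insert_self 1 l.parts.toFinset), h1]
    rw [Nat.factorial_zero, one_mul]
    congr 1
    · congr 1; omega
    · exact Finset.prod_congr rfl fun j hj => by rw [hcount j (Finset.ne_of_mem_erase hj)]
  have key := Equiv.Perm.card_of_cycleType_mul_eq α m
  rw [if_pos ⟨by omega, fun a ha => (Multiset.mem_filter.1 ha).2⟩] at key
  rw [hset, hfac, ← key, hprod]
  ring

/-! ### Ewens weights of partitions and removal of a cycle -/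

noncomputable section

/-- The Ewens weight of a partition, normalised so that the weights of all partitions of `n` sum up
to `risingFactorial θ n / n!`. -/
def partWeight (θ : ℝ) (m : Multiset ℕ) : ℝ :=
  θ ^ m.card / ((m.prod : ℝ) * ∏ j ∈ m.toFinset, ((m.count j)! : ℝ))

/-- The unnormalised Ewens expectation of a function of the cycle lengths. -/
def ewensSum (θ : ℝ) (n : ℕ) (f : Multiset ℕ → ℝ) : ℝ :=
  ∑ l : n.Partition, partWeight θ l.parts * f l.parts

end

theorem partWeight_nonneg {θ : ℝ} (hθ : 0 < θ) (m : Multiset ℕ) : 0 ≤ partWeight θ m := by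
  unfold partWeight; positivity

theorem ewensSum_mono {θ : ℝ} (hθ : 0 < θ) {n : ℕ} {f g : Multiset ℕ → ℝ}
    (h : ∀ l : n.Partition, f l.parts ≤ g l.parts) : ewensSum θ n f ≤ ewensSum θ n g :=
  Finset.sum_le_sum fun l _ => mul_le_mul_of_nonneg_left (h l) (partWeight_nonneg hθ _)

theorem ewensSum_congr {θ : ℝ} {n : ℕ} {f g : Multiset ℕ → ℝ}
    (h : ∀ l : n.Partition, f l.parts = g l.parts) : ewensSum θ n f = ewensSum θ n g :=
  Finset.sum_congr rfl fun l _ => by rw [h l]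

theorem ewensSum_add {θ : ℝ} {n : ℕ} (f g : Multiset ℕ → ℝ) :
    ewensSum θ n (fun m => f m + g m) = ewensSum θ n f + ewensSum θ n g := by
  simp [ewensSum, mul_add, Finset.sum_add_distrib]

theorem ewensSum_sub {θ : ℝ} {n : ℕ} (f g : Multiset ℕ → ℝ) :
    ewensSum θ n (fun m => f m - g m) = ewensSum θ n f - ewensSum θ n g := by
  simp [ewensSum, mul_sub, Finset.sum_sub_distrib]

theorem ewensSum_const_mul {θ : ℝ} {n : ℕ} (c : ℝ) (f : Multiset ℕ → ℝ) :
    ewensSum θ n (fun m => c * f m) = c * ewensSum θ n f := by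
  simp only [ewensSum, Finset.mul_sum]
  exact Finset.sum_congr rfl fun l _ => by ring

theorem ewensSum_sum {θ : ℝ} {n : ℕ} {ι : Type*} (S : Finset ι) (f : ι → Multiset ℕ → ℝ) :
    ewensSum θ n (fun m => ∑ i ∈ S, f i m) = ∑ i ∈ S, ewensSum θ n (f i) := by
  simp only [ewensSum, Finset.mul_sum]
  exact Finset.sum_comm

theorem sum_perm_eq {α : Type*} [Fintype α] [DecidableEq α] (g : Multiset ℕ → ℝ) :
    ∑ σ : Equiv.Perm α, g σ.partition.parts =
      (Fintype.card α)! * ∑ l : (Fintype.card α).Partition,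
        g l.parts / ((l.parts.prod : ℝ) * ∏ j ∈ l.parts.toFinset, ((l.parts.count j)! : ℝ)) := by
  rw [← Finset.sum_fiberwise Finset.univ (fun σ : Equiv.Perm α => σ.partition), Finset.mul_sum]
  refine Finset.sum_congr rfl fun l _ => ?_
  have h1 : ∑ σ ∈ Finset.univ.filter (fun σ : Equiv.Perm α => σ.partition = l),
      g σ.partition.parts =
      ((Finset.univ.filter fun σ : Equiv.Perm α => σ.partition = l).card : ℝ) * g l.parts := by
    rw [← nsmul_eq_mul]
    refine Finset.sum_eq_card_nsmul fun σ hσ => ?_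
    rw [(Finset.mem_filter.1 hσ).2]
  have h2 : ((l.parts.prod : ℝ) * ∏ j ∈ l.parts.toFinset, ((l.parts.count j)! : ℝ)) ≠ 0 := by
    have : 0 < l.parts.prod := Multiset.prod_pos fun a ha => l.parts_pos ha
    positivity
  have h3 := card_partition_eq_mul l
  have h4 : ((Finset.univ.filter fun σ : Equiv.Perm α => σ.partition = l).card : ℝ) *
      ((l.parts.prod : ℝ) * ∏ j ∈ l.parts.toFinset, ((l.parts.count j)! : ℝ)) =
      ((Fintype.card α)! : ℝ) := by
    rw [← h3]; push_cast; ring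
  rw [h1, ← h4, mul_assoc, mul_div_cancel₀ _ h2]

theorem sum_card_eq {N n : ℕ} (h : N = n) (F : Multiset ℕ → ℝ) :
    ∑ l : N.Partition, F l.parts = ∑ l : n.Partition, F l.parts := by
  subst h; rfl

theorem numCycles_eq_card {n : ℕ} (σ : Equiv.Perm (Fin n)) :
    numCycles σ = σ.partition.parts.card := by
  unfold numCycles cycleCount
  refine Multiset.sum_count_eq_card fun a ha => ?_
  rw [Finset.mem_Icc]
  refine ⟨σ.partition.parts_pos ha, ?_⟩
  have := Nat.Partition.le_of_mem_parts ha
  rwa [Fintype.card_fin] at this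

/-- Ewens sums over permutations are Ewens sums over partitions. -/
theorem sum_pow_numCycles_mul (θ : ℝ) (n : ℕ) (f : Multiset ℕ → ℝ) :
    ∑ σ : Equiv.Perm (Fin n), θ ^ numCycles σ * f σ.partition.parts = n ! * ewensSum θ n f := by
  simp_rw [numCycles_eq_card]
  rw [sum_perm_eq (fun m => θ ^ m.card * f m), ewensSum,
    sum_card_eq (Fintype.card_fin n) (fun m => θ ^ m.card * f m /
      ((m.prod : ℝ) * ∏ j ∈ m.toFinset, ((m.count j)! : ℝ))), Fintype.card_fin]
  congr 1
  refine Finset.sum_congr rfl fun l _ => ?_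
  unfold partWeight
  ring

/-- A new part j contributes θ to the numerator, and j and `m.count j + 1` to the denominator.
Keeping the last factor on the left yields the marking identity for cycles. -/
theorem partWeight_cons (θ : ℝ) (j : ℕ) (m : Multiset ℕ) :
    partWeight θ (j ::ₘ m) * (m.count j + 1) = θ / j * partWeight θ m := by
  have e1 : ∏ i ∈ (j ::ₘ m).toFinset, (((j ::ₘ m).count i)! : ℝ) =
      (m.count j + 1) * ∏ i ∈ m.toFinset, ((m.count i)! : ℝ) := by
    have h1 := prod_factorial_count_subset (m := m) (S := insert j m.toFinset)
      (Finset.subset_insert _ _)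
    rw [← Finset.mul_prod_erase _ _ (Finset.mem_insert_self j m.toFinset)] at h1
    have h2 : ∏ i ∈ (j ::ₘ m).toFinset, ((j ::ₘ m).count i)! =
        (m.count j + 1) * ∏ i ∈ m.toFinset, (m.count i)! := by
      rw [h1, Multiset.toFinset_cons,
        ← Finset.mul_prod_erase _ _ (Finset.mem_insert_self j m.toFinset),
        Multiset.count_cons_self, Nat.factorial_succ, mul_assoc]
      congr 2
      exact Finset.prod_congr rfl fun i hi => by
        rw [Multiset.count_cons_of_ne (Finset.ne_of_mem_erase hi)]
    exact_mod_cast h2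
  unfold partWeight
  rw [e1, Multiset.card_cons, Multiset.prod_cons]
  have h0 : (m.count j + 1 : ℝ) ≠ 0 := by positivity
  rw [Nat.cast_mul, div_mul_eq_mul_div, div_mul_div_comm, pow_succ,
    show θ ^ m.card * θ * ((m.count j : ℝ) + 1) = θ * θ ^ m.card * (m.count j + 1) by ring,
    show (j : ℝ) * (m.prod : ℝ) * ((m.count j + 1) * ∏ i ∈ m.toFinset, ((m.count i)! : ℝ)) =
      j * ((m.prod : ℝ) * ∏ i ∈ m.toFinset, ((m.count i)! : ℝ)) * (m.count j + 1) by ring,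
    mul_div_mul_right _ _ h0]

/-- Weighting by the number of cycles of length `j` amounts to adding a cycle of length `j`. -/
theorem ewensSum_count_mul (θ : ℝ) {n j : ℕ} (hj : 0 < j) (f : Multiset ℕ → ℝ) :
    ewensSum θ n (fun m => m.count j * f m) =
      if j ≤ n then θ / j * ewensSum θ (n - j) (fun m => f (j ::ₘ m)) else 0 := by
  split_ifs with hjn
  · unfold ewensSum
    have h1 : ∑ l : n.Partition, partWeight θ l.parts * (l.parts.count j * f l.parts) =
        ∑ l : {p : n.Partition // j ∈ p.parts},
          partWeight θ l.1.parts * (l.1.parts.count j * f l.1.parts) := by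
      rw [← Finset.sum_subtype (Finset.univ.filter fun l : n.Partition => j ∈ l.parts) (by simp)
        (fun l : n.Partition => partWeight θ l.parts * (l.parts.count j * f l.parts))]
      refine (Finset.sum_filter_of_ne fun l _ hl => ?_).symm
      by_contra h
      simp [Multiset.count_eq_zero_of_notMem h] at hl
    rw [h1, Finset.mul_sum, ← (Nat.Partition.partitionWithPartEquiv hj hjn).symm.sum_comp]
    refine Finset.sum_congr rfl fun l _ => ?_
    simp only [Nat.Partition.partitionWithPartEquiv_symm_apply_parts, Multiset.count_cons_self]
    have := partWeight_cons θ j l.parts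
    push_cast
    rw [← mul_assoc, this]
    ring
  · refine Finset.sum_eq_zero fun l _ => ?_
    have : j ∉ l.parts := fun h => hjn (Nat.Partition.le_of_mem_parts h)
    simp [Multiset.count_eq_zero_of_notMem this]

/-! ### The total mass θ^{(n)}/n! -/

noncomputable section

/-- The total mass `θ^{(n)} / n!` of the Ewens weights of the partitions of `n`. -/
def ewensMass (θ : ℝ) (n : ℕ) : ℝ := risingFactorial θ n / n !

/-- The number of parts of `m` that lie in `S`. -/
def partsIn (S : Finset ℕ) (m : Multiset ℕ) : ℕ := ∑ j ∈ S, m.count j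

/-- The `l`-fold convolution of `g` with the function `j ↦ 1 / j` on `S`. -/
def convIter (S : Finset ℕ) : ℕ → (ℕ → ℝ) → ℕ → ℝ
  | 0, g, k => g k
  | l + 1, g, k => ∑ j ∈ S.filter (· ≤ k), 1 / (j : ℝ) * convIter S l g (k - j)

end

section mass

variable {θ : ℝ}

theorem ewensMass_zero : ewensMass θ 0 = 1 := by simp [ewensMass, risingFactorial]

theorem succ_mul_ewensMass (n : ℕ) :
    (n + 1 : ℝ) * ewensMass θ (n + 1) = (θ + n) * ewensMass θ n := by
  unfold ewensMass risingFactorial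
  rw [Finset.prod_range_succ, Nat.factorial_succ]
  have : (n ! : ℝ) ≠ 0 := by positivity
  push_cast
  field_simp

theorem ewensMass_pos (hθ : 0 < θ) (n : ℕ) : 0 < ewensMass θ n := by
  unfold ewensMass risingFactorial
  have : 0 < ∏ i ∈ Finset.range n, (θ + (i : ℝ)) := Finset.prod_pos fun i _ => by positivity
  positivity

theorem sum_range_ewensMass (n : ℕ) :
    θ * ∑ i ∈ Finset.range n, ewensMass θ i = n * ewensMass θ n := by
  induction n with
  | zero => simp
  | succ n ih =>
    rw [Finset.sum_range_succ, mul_add, ih]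
    push_cast
    rw [succ_mul_ewensMass]
    ring

/-- Monotonicity that holds for every θ > 0, whereas the mass itself may increase or decrease. -/
theorem mul_ewensMass_mono (hθ : 0 < θ) : Monotone fun n : ℕ => (n : ℝ) * ewensMass θ n := by
  refine monotone_nat_of_le_succ fun n => ?_
  push_cast
  rw [succ_mul_ewensMass]
  nlinarith [ewensMass_pos hθ n]

/-- The assumption θ ≤ 1 of the converse is needed only for this. -/
theorem ewensMass_antitone (hθ : 0 < θ) (hθ1 : θ ≤ 1) : Antitone (ewensMass θ) := by
  refine antitone_nat_of_succ_le fun n => ?_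
  have h := succ_mul_ewensMass (θ := θ) n
  have hp := ewensMass_pos hθ n
  have hn : (0 : ℝ) < n + 1 := by positivity
  refine le_of_mul_le_mul_left ?_ hn
  rw [h]
  nlinarith

theorem sum_Icc_sub_eq (n : ℕ) (g : ℕ → ℝ) :
    ∑ j ∈ Finset.Icc 1 n, g (n - j) = ∑ i ∈ Finset.range n, g i := by
  refine Finset.sum_nbij' (fun j => n - j) (fun i => n - i) ?_ ?_ ?_ ?_ ?_
  all_goals simp only [Finset.mem_Icc, Finset.mem_range]
  all_goals intros
  all_goals first | omega | trivial

/-- Since n = ∑ j k_j, removing a marked cycle gives the recursion n s(n) = θ ∑_{i<n} s(i), which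
the mass satisfies by `sum_range_ewensMass`. -/
theorem ewensSum_one (hθ : 0 < θ) (n : ℕ) : ewensSum θ n (fun _ => 1) = ewensMass θ n := by
  induction n using Nat.strong_induction_on with
  | _ n ih =>
    rcases Nat.eq_zero_or_pos n with rfl | hn
    · simp [ewensSum, ewensMass_zero, partWeight]
    have h1 : (n : ℝ) * ewensSum θ n (fun _ => 1) =
        ewensSum θ n (fun m => ∑ j ∈ Finset.Icc 1 n, (j : ℝ) * (m.count j * 1)) := by
      rw [← ewensSum_const_mul]
      refine ewensSum_congr fun l => ?_
      have h2 : ∑ j ∈ Finset.Icc 1 n, l.parts.count j * j = n := by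
        conv_rhs => rw [← l.parts_sum, Finset.sum_multiset_count]
        refine (Finset.sum_subset ?_ ?_).symm
        · intro j hj
          rw [Multiset.mem_toFinset] at hj
          exact Finset.mem_Icc.2 ⟨l.parts_pos hj, Nat.Partition.le_of_mem_parts hj⟩
        · intro j _ hj
          rw [Multiset.mem_toFinset] at hj
          simp [Multiset.count_eq_zero_of_notMem hj]
      have h3 : (n : ℝ) = ∑ j ∈ Finset.Icc 1 n, (l.parts.count j : ℝ) * j := by
        exact_mod_cast h2.symm
      simp only [mul_one]
      rw [h3]
      exact Finset.sum_congr rfl fun j _ => mul_comm _ _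
    have h4 : (n : ℝ) * ewensSum θ n (fun _ => 1) = n * ewensMass θ n := by
      rw [h1, ewensSum_sum, ← sum_range_ewensMass, ← sum_Icc_sub_eq, Finset.mul_sum]
      refine Finset.sum_congr rfl fun j hj => ?_
      rw [Finset.mem_Icc] at hj
      have hj0 : (j : ℝ) ≠ 0 := by have := hj.1; positivity
      rw [ewensSum_const_mul, ewensSum_count_mul θ hj.1, if_pos hj.2, ih (n - j) (by omega)]
      field_simp
    exact mul_left_cancel₀ (by positivity) h4

/-- Ewens probabilities as normalised sums over partitions. -/
theorem ewensProb_eq (θ : ℝ) (n : ℕ) (A : Set (Multiset ℕ)) :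
    ewensProb θ n {σ | σ.partition.parts ∈ A} =
      ewensSum θ n (A.indicator fun _ => 1) / ewensMass θ n := by
  unfold ewensProb
  have h : ∑ σ : Equiv.Perm (Fin n),
      ({σ | σ.partition.parts ∈ A} : Set (Equiv.Perm (Fin n))).indicator
        (fun σ => θ ^ numCycles σ) σ =
      ∑ σ : Equiv.Perm (Fin n), θ ^ numCycles σ *
        A.indicator (fun _ => (1 : ℝ)) σ.partition.parts := by
    refine Finset.sum_congr rfl fun σ _ => ?_
    by_cases hσ : σ.partition.parts ∈ A <;> simp [hσ]
  rw [h, sum_pow_numCycles_mul θ n (A.indicator fun _ => 1)]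
  unfold ewensMass
  rw [div_div_eq_mul_div]
  ring

end mass

/-! ### Iterated convolutions and factorial moments -/

section conv

variable {S : Finset ℕ}

theorem convIter_nonneg {g : ℕ → ℝ} (hg : ∀ k, 0 ≤ g k) (l k : ℕ) : 0 ≤ convIter S l g k := by
  induction l generalizing k with
  | zero => exact hg k
  | succ l ih => exact Finset.sum_nonneg fun j _ => mul_nonneg (by positivity) (ih _)

theorem abs_convIter_sub_le (g h : ℕ → ℝ) (l k : ℕ) :
    |convIter S l g k - convIter S l h k| ≤ convIter S l (fun i => |g i - h i|) k := by
  induction l generalizing k with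
  | zero => exact le_rfl
  | succ l ih =>
    simp only [convIter]
    rw [← Finset.sum_sub_distrib]
    refine (Finset.abs_sum_le_sum_abs _ _).trans (Finset.sum_le_sum fun j _ => ?_)
    rw [← mul_sub, abs_mul, abs_of_nonneg (by positivity : (0 : ℝ) ≤ 1 / (j : ℝ))]
    exact mul_le_mul_of_nonneg_left (ih _) (by positivity)

theorem convIter_div (g : ℕ → ℝ) (c : ℝ) (l k : ℕ) :
    convIter S l (fun i => g i / c) k = convIter S l g k / c := by
  induction l generalizing k with
  | zero => rfl
  | succ l ih =>
    simp only [convIter, ih, Finset.sum_div, mul_div_assoc]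

theorem convIter_succ_le {g : ℕ → ℝ} {C : ℝ} (h : ∀ k, convIter S 1 g k ≤ C * g k) (l k : ℕ) :
    convIter S (l + 1) g k ≤ C * convIter S l g k := by
  induction l generalizing k with
  | zero => exact h k
  | succ l ih =>
    rw [convIter, convIter, Finset.mul_sum]
    refine Finset.sum_le_sum fun j _ => ?_
    calc 1 / (j : ℝ) * convIter S (l + 1) g (k - j)
        ≤ 1 / (j : ℝ) * (C * convIter S l g (k - j)) :=
          mul_le_mul_of_nonneg_left (ih _) (by positivity)
      _ = _ := by ring

theorem sum_filter_sub_le {g : ℕ → ℝ} (hS : ∀ j ∈ S, 0 < j) (hg : ∀ k, 0 ≤ g k) (k : ℕ) :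
    ∑ j ∈ S.filter (· ≤ k), g (k - j) ≤ ∑ i ∈ Finset.range k, g i := by
  rw [← sum_Icc_sub_eq]
  refine Finset.sum_le_sum_of_subset_of_nonneg (fun j hj => ?_) fun _ _ _ => hg _
  rw [Finset.mem_filter] at hj
  exact Finset.mem_Icc.2 ⟨hS j hj.1, hj.2⟩

/-- Each weight 1/j is at most L/n. The innermost convolution costs L/n times the sum of g; each
further one has at most n terms and so costs a factor L. -/
theorem convIter_le_sum_range {g : ℕ → ℝ} (hg : ∀ k, 0 ≤ g k) {n L : ℕ} (hn : 0 < n)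
    (hS : ∀ j ∈ S, n ≤ L * j) (hcard : S.card ≤ n) (l k : ℕ) :
    convIter S (l + 1) g k ≤ (L : ℝ) ^ (l + 1) / n * ∑ i ∈ Finset.range k, g i := by
  have hpos : ∀ j ∈ S, 0 < j := fun j hj => by
    rcases Nat.eq_zero_or_pos j with rfl | h
    · have := hS 0 hj; omega
    · exact h
  have hn' : (0 : ℝ) < n := by exact_mod_cast hn
  have hinv : ∀ j ∈ S, 1 / (j : ℝ) ≤ L / n := fun j hj => by
    have : (0 : ℝ) < j := by exact_mod_cast hpos j hj
    rw [div_le_div_iff₀ this hn', one_mul]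
    exact_mod_cast hS j hj
  induction l generalizing k with
  | zero =>
    simp only [convIter, zero_add, pow_one]
    calc ∑ j ∈ S.filter (· ≤ k), 1 / (j : ℝ) * g (k - j)
        ≤ ∑ j ∈ S.filter (· ≤ k), (L : ℝ) / n * g (k - j) :=
          Finset.sum_le_sum fun j hj =>
            mul_le_mul_of_nonneg_right (hinv j (Finset.mem_filter.1 hj).1) (hg _)
      _ = (L : ℝ) / n * ∑ j ∈ S.filter (· ≤ k), g (k - j) := by rw [Finset.mul_sum]
      _ ≤ _ := mul_le_mul_of_nonneg_left (sum_filter_sub_le hpos hg k) (by positivity)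
  | succ l ih =>
    set G := ∑ i ∈ Finset.range k, g i with hG
    have hG0 : 0 ≤ G := Finset.sum_nonneg fun _ _ => hg _
    rw [convIter]
    calc ∑ j ∈ S.filter (· ≤ k), 1 / (j : ℝ) * convIter S (l + 1) g (k - j)
        ≤ ∑ j ∈ S.filter (· ≤ k), (L : ℝ) / n * ((L : ℝ) ^ (l + 1) / n * G) := by
          refine Finset.sum_le_sum fun j hj => mul_le_mul (hinv j (Finset.mem_filter.1 hj).1)
            ((ih _).trans (mul_le_mul_of_nonneg_left ?_ (by positivity)))
            (convIter_nonneg hg _ _) (by positivity)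
          exact Finset.sum_le_sum_of_subset_of_nonneg
            (Finset.range_mono (Nat.sub_le _ _)) fun _ _ _ => hg _
      _ = (S.filter (· ≤ k)).card * ((L : ℝ) / n * ((L : ℝ) ^ (l + 1) / n * G)) := by
          rw [Finset.sum_const, nsmul_eq_mul]
      _ ≤ n * ((L : ℝ) / n * ((L : ℝ) ^ (l + 1) / n * G)) := by
          refine mul_le_mul_of_nonneg_right ?_ (by positivity)
          exact_mod_cast (Finset.card_filter_le _ _).trans hcard
      _ = (L : ℝ) ^ (l + 1 + 1) / n * G := by
          rw [pow_succ _ (l + 1)]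
          field_simp

/-- The iterated convolution as a sum over tuples. -/
theorem convIter_eq_sum (g : ℕ → ℝ) (l k : ℕ) :
    convIter S l g k = ∑ j ∈ Fintype.piFinset (fun _ : Fin l => S),
      if ∑ i, j i ≤ k then 1 / (∏ i, (j i : ℝ)) * g (k - ∑ i, j i) else 0 := by
  induction l generalizing k with
  | zero => simp [convIter]
  | succ l ih =>
    have h : ∀ F : (Fin (l + 1) → ℕ) → ℝ,
        ∑ j ∈ Fintype.piFinset (fun _ : Fin (l + 1) => S), F j =
        ∑ a ∈ S, ∑ j ∈ Fintype.piFinset (fun _ : Fin l => S), F (Fin.cons a j) := by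
      intro F
      rw [← Finset.sum_product']
      refine Finset.sum_nbij' (fun j => (j 0, Fin.tail j)) (fun x => Fin.cons x.1 x.2)
        ?_ ?_ ?_ ?_ ?_
      · intro j hj
        rw [Fin.mem_piFinset_iff_zero_tail] at hj
        exact Finset.mem_product.2 hj
      · intro x hx
        rw [Fin.mem_piFinset_iff_zero_tail]
        exact Finset.mem_product.1 hx
      · intro j _
        exact Fin.cons_self_tail j
      · intro x _
        simp
      · intro j _
        simp only [Fin.cons_self_tail]
    rw [h, convIter, Finset.sum_filter]
    refine Finset.sum_congr rfl fun a _ => ?_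
    simp only [Fin.sum_univ_succ, Fin.prod_univ_succ, Fin.cons_zero, Fin.cons_succ]
    split_ifs with hak
    · rw [ih, Finset.mul_sum]
      refine Finset.sum_congr rfl fun j _ => ?_
      by_cases hj : ∑ i, j i ≤ k - a
      · rw [if_pos hj, if_pos (by omega), Nat.sub_sub, ← mul_assoc, one_div_mul_one_div]
      · rw [if_neg hj, if_neg (by omega), mul_zero]
    · refine (Finset.sum_eq_zero fun j _ => ?_).symm
      rw [if_neg (by omega)]

theorem partsIn_cons {j : ℕ} (hj : j ∈ S) (m : Multiset ℕ) :
    partsIn S (j ::ₘ m) = partsIn S m + 1 := by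
  unfold partsIn
  simp only [Multiset.count_cons, Finset.sum_add_distrib]
  simp [hj]

/-- The factorial moments of the number of parts in `S`. -/
theorem ewensSum_descFactorial {θ : ℝ} (hθ : 0 < θ) (hS : ∀ j ∈ S, 0 < j) (l n : ℕ) :
    ewensSum θ n (fun m => ((partsIn S m).descFactorial l : ℝ)) =
      θ ^ l * convIter S l (ewensMass θ) n := by
  induction l generalizing n with
  | zero => simpa [convIter] using ewensSum_one hθ n
  | succ l ih =>
    -- One factor of the falling factorial is spread over the counts. Adding the marked part back
    -- cancels the -1; when there are no parts in S, the truncated subtraction is multiplied by 0.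
    have h1 : ∀ m : Multiset ℕ, ((partsIn S m).descFactorial (l + 1) : ℝ) =
        ∑ j ∈ S, (m.count j : ℝ) * ((partsIn S m - 1).descFactorial l : ℝ) := by
      intro m
      rw [← Finset.sum_mul]
      have : ∑ j ∈ S, (m.count j : ℝ) = (partsIn S m : ℝ) := by simp [partsIn]
      rw [this]
      rcases hm : partsIn S m with _ | r
      · simp
      · rw [Nat.succ_descFactorial_succ]; push_cast; simp
    simp_rw [h1]
    rw [ewensSum_sum, convIter, Finset.mul_sum, Finset.sum_filter]
    refine Finset.sum_congr rfl fun j hj => ?_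
    rw [ewensSum_count_mul θ (hS j hj)]
    refine if_congr Iff.rfl ?_ rfl
    simp only [partsIn_cons hj, Nat.add_sub_cancel]
    rw [ih]
    ring

/-- Split p(k-j)/j = (k-j)p(k-j)/(jk) + p(k-j)/k. The first term is at most p(k)/j by
`mul_ewensMass_mono`; the second sums to at most p(k)/θ. -/
theorem convIter_one_ewensMass_le {θ : ℝ} (hθ : 0 < θ) (hS : ∀ j ∈ S, 0 < j) (k : ℕ) :
    convIter S 1 (ewensMass θ) k ≤ (∑ j ∈ S, 1 / (j : ℝ) + 1 / θ) * ewensMass θ k := by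
  have hp := ewensMass_pos hθ
  rcases Nat.eq_zero_or_pos k with rfl | hk
  · have : convIter S 1 (ewensMass θ) 0 = 0 := by
      refine Finset.sum_eq_zero fun j hj => ?_
      rw [Finset.mem_filter] at hj
      have := hS j hj.1
      omega
    rw [this]
    have := hp 0
    positivity
  have hk' : (0 : ℝ) < k := by exact_mod_cast hk
  have h1 : ∀ j ∈ S.filter (· ≤ k), 1 / (j : ℝ) * ewensMass θ (k - j) ≤
      1 / (j : ℝ) * ewensMass θ k + 1 / k * ewensMass θ (k - j) := by
    intro j hj
    rw [Finset.mem_filter] at hj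
    have hj0 : (0 : ℝ) < j := by exact_mod_cast hS j hj.1
    have h2 : ((k - j : ℕ) : ℝ) * ewensMass θ (k - j) ≤ k * ewensMass θ k :=
      mul_ewensMass_mono hθ (Nat.sub_le k j)
    rw [Nat.cast_sub hj.2] at h2
    calc 1 / (j : ℝ) * ewensMass θ (k - j)
        = 1 / (j * k) * ((k - j) * ewensMass θ (k - j)) + 1 / k * ewensMass θ (k - j) := by
          field_simp; ring
      _ ≤ 1 / (j * k) * (k * ewensMass θ k) + 1 / k * ewensMass θ (k - j) := by gcongr
      _ = _ := by field_simp
  have h3 : ∑ j ∈ S.filter (· ≤ k), 1 / (j : ℝ) * ewensMass θ k ≤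
      (∑ j ∈ S, 1 / (j : ℝ)) * ewensMass θ k := by
    rw [Finset.sum_mul]
    refine Finset.sum_le_sum_of_subset_of_nonneg (Finset.filter_subset _ _) fun j _ _ => ?_
    have := hp k
    positivity
  have h4 := sum_filter_sub_le (S := S) hS (fun i => (hp i).le) k
  have h5 := sum_range_ewensMass (θ := θ) k
  calc convIter S 1 (ewensMass θ) k
      = ∑ j ∈ S.filter (· ≤ k), 1 / (j : ℝ) * ewensMass θ (k - j) := rfl
    _ ≤ ∑ j ∈ S.filter (· ≤ k), (1 / (j : ℝ) * ewensMass θ k + 1 / k * ewensMass θ (k - j)) :=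
        Finset.sum_le_sum h1
    _ = ∑ j ∈ S.filter (· ≤ k), 1 / (j : ℝ) * ewensMass θ k +
        1 / k * ∑ j ∈ S.filter (· ≤ k), ewensMass θ (k - j) := by
        rw [Finset.sum_add_distrib, Finset.mul_sum]
    _ ≤ (∑ j ∈ S, 1 / (j : ℝ)) * ewensMass θ k +
        1 / k * ∑ i ∈ Finset.range k, ewensMass θ i := by gcongr
    _ = _ := by
        have : ∑ i ∈ Finset.range k, ewensMass θ i = k * ewensMass θ k / θ := by
          rw [← h5]; field_simp
        rw [this]
        field_simp

/-- As l * b ≤ n, every l-tuple from S fits into n, so no term is cut off, and p(n - ∑ j_i) ≥ p(n).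
-/
theorem pow_mul_ewensMass_le_convIter {θ : ℝ} (hθ : 0 < θ) (hθ1 : θ ≤ 1) {b : ℕ}
    (hS : ∀ j ∈ S, j ≤ b) (l n : ℕ) (hn : l * b ≤ n) :
    (∑ j ∈ S, 1 / (j : ℝ)) ^ l * ewensMass θ n ≤ convIter S l (ewensMass θ) n := by
  induction l generalizing n with
  | zero => simp [convIter]
  | succ l ih =>
    have hb : l * b + b ≤ n := by rwa [Nat.succ_mul] at hn
    have hfil : S.filter (· ≤ n) = S := Finset.filter_true_of_mem fun j hj => by
      have := hS j hj; omega
    rw [convIter, hfil, pow_succ, mul_comm (_ ^ l), mul_assoc, Finset.sum_mul]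
    refine Finset.sum_le_sum fun j hj => mul_le_mul_of_nonneg_left ?_ (by positivity)
    have hjb := hS j hj
    refine le_trans (mul_le_mul_of_nonneg_left ?_ ?_) (ih (n - j) (by omega))
    · exact ewensMass_antitone hθ hθ1 (Nat.sub_le _ _)
    · exact pow_nonneg (Finset.sum_nonneg fun _ _ => by positivity) _

end conv

/-! ### Asymptotics of the mass -/

section asymptotics

variable {θ : ℝ}

/-- Euler's limit formula for Γ: the left side equals n/(n+θ) divided by `Real.GammaSeq θ n`. -/
theorem tendsto_ewensMass_mul_rpow (hθ : 0 < θ) :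
    Tendsto (fun n : ℕ => ewensMass θ n * (n : ℝ) ^ (1 - θ)) atTop (𝓝 (Real.Gamma θ)⁻¹) := by
  have h1 : Tendsto (fun n : ℕ => (n : ℝ) / (n + θ)) atTop (𝓝 1) :=
    tendsto_natCast_div_add_atTop θ
  have h2 := (Real.GammaSeq_tendsto_Gamma θ).inv₀ (Real.Gamma_pos_of_pos hθ).ne'
  have h3 := h1.mul h2
  rw [one_mul] at h3
  refine h3.congr' ?_
  filter_upwards [eventually_gt_atTop 0] with n hn
  have hn' : (0 : ℝ) < n := by exact_mod_cast hn
  unfold Real.GammaSeq ewensMass risingFactorial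
  rw [Finset.prod_range_succ, Real.rpow_sub hn', Real.rpow_one]
  have h4 : (0 : ℝ) < ∏ i ∈ Finset.range n, (θ + (i : ℝ)) :=
    Finset.prod_pos fun i _ => by positivity
  have h5 : (0 : ℝ) < n ! := by positivity
  have h6 : (0 : ℝ) < (n : ℝ) ^ θ := by positivity
  have h7 : (0 : ℝ) < θ + n := by positivity
  rw [add_comm (n : ℝ) θ]
  field_simp

theorem tendsto_mul_ewensMass (hθ : 0 < θ) :
    Tendsto (fun n : ℕ => (n : ℝ) * ewensMass θ n) atTop atTop := by
  have h1 : Tendsto (fun n : ℕ => (n : ℝ) ^ θ) atTop atTop :=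
    (tendsto_rpow_atTop hθ).comp tendsto_natCast_atTop_atTop
  have h2 := (tendsto_ewensMass_mul_rpow hθ).pos_mul_atTop
    (inv_pos.2 (Real.Gamma_pos_of_pos hθ)) h1
  refine h2.congr' ?_
  filter_upwards [eventually_gt_atTop 0] with n hn
  have hn' : (0 : ℝ) < n := by exact_mod_cast hn
  rw [mul_assoc, ← Real.rpow_add hn', sub_add_cancel, Real.rpow_one, mul_comm]

noncomputable section

/-- The limiting density `(i / n) ^ (θ - 1)`, with the value `0` at `i = 0`. -/
def powDensity (θ : ℝ) (n i : ℕ) : ℝ := if i = 0 then 0 else ((i : ℝ) / n) ^ (θ - 1)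

/-- The mean absolute difference of `ewensMass θ i / ewensMass θ n` and its limiting density. -/
def massError (θ : ℝ) (n : ℕ) : ℝ :=
  1 / n * ∑ i ∈ Finset.range n, |ewensMass θ i / ewensMass θ n - powDensity θ n i|

end

/-- The approximation is not uniform near i = 0, so it is measured in the mean. The relative error
`q` is small once i and n are large, and the weights p(i)/(n p(n)) sum to 1/θ; the finitely many
remaining i vanish because n p(n) → ∞. -/
theorem tendsto_massError (hθ : 0 < θ) : Tendsto (massError θ) atTop (𝓝 0) := by
  set a : ℕ → ℝ := fun n => ewensMass θ n * (n : ℝ) ^ (1 - θ) with ha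
  have hp := ewensMass_pos hθ
  have hc : (0 : ℝ) < (Real.Gamma θ)⁻¹ := inv_pos.2 (Real.Gamma_pos_of_pos hθ)
  have hac : Tendsto a atTop (𝓝 (Real.Gamma θ)⁻¹) := tendsto_ewensMass_mul_rpow hθ
  set q : ℕ → ℕ → ℝ := fun n i => if i = 0 then 1 else |1 - a n / a i| with hq
  have hterm : ∀ n i : ℕ, 0 < n → |ewensMass θ i / ewensMass θ n - powDensity θ n i| =
      ewensMass θ i / ewensMass θ n * q n i := by
    intro n i hn
    have hr : 0 ≤ ewensMass θ i / ewensMass θ n := (div_pos (hp i) (hp n)).le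
    simp only [hq, powDensity]
    split_ifs with hi
    · rw [sub_zero, mul_one, abs_of_nonneg hr]
    · have hi' : (0 : ℝ) < i := by exact_mod_cast Nat.pos_of_ne_zero hi
      have hn' : (0 : ℝ) < n := by exact_mod_cast hn
      rw [← abs_of_nonneg hr, ← abs_mul, abs_of_nonneg hr]
      congr 1
      rw [mul_sub, mul_one]
      congr 1
      rw [Real.div_rpow hi'.le hn'.le, ← neg_sub 1 θ, Real.rpow_neg hi'.le, Real.rpow_neg hn'.le]
      have h1 : (0 : ℝ) < (i : ℝ) ^ (1 - θ) := by positivity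
      have h2 : (0 : ℝ) < (n : ℝ) ^ (1 - θ) := by positivity
      have := hp i
      have := hp n
      simp only [ha]
      field_simp
  have hq0 : ∀ n i, 0 ≤ q n i := fun n i => by simp only [hq]; split_ifs <;> positivity
  have hqlim : Tendsto (fun x : ℕ × ℕ => |1 - a x.1 / a x.2|) atTop (𝓝 0) := by
    rw [← prod_atTop_atTop_eq]
    have h1 : Tendsto (fun x : ℕ × ℕ => a x.1) (atTop ×ˢ atTop) (𝓝 (Real.Gamma θ)⁻¹) :=
      hac.comp tendsto_fst
    have h2 : Tendsto (fun x : ℕ × ℕ => a x.2) (atTop ×ˢ atTop) (𝓝 (Real.Gamma θ)⁻¹) :=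
      hac.comp tendsto_snd
    have h3 := ((h1.div h2 hc.ne').const_sub 1).abs
    simpa [div_self hc.ne'] using h3
  rw [Metric.tendsto_atTop]
  intro ε hε
  have hev := hqlim.eventually (gt_mem_nhds (show (0 : ℝ) < ε * θ / 4 by positivity))
  rw [eventually_atTop_prod_self'] at hev
  obtain ⟨N₀, hN₀⟩ := hev
  -- The shift by 1 keeps i = 0, where `q` is 1, in the finite head.
  set N := N₀ + 1 with hN
  have hsmall : Tendsto (fun n : ℕ => ∑ i ∈ Finset.range N,
      ewensMass θ i * ((n : ℝ) * ewensMass θ n)⁻¹ * q n i) atTop (𝓝 0) := by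
    have h0 : (0 : ℝ) = ∑ i ∈ Finset.range N, 0 := by simp
    rw [h0]
    refine tendsto_finsetSum _ fun i _ => ?_
    have h1 : Tendsto (fun n : ℕ => ewensMass θ i * ((n : ℝ) * ewensMass θ n)⁻¹) atTop (𝓝 0) := by
      simpa using (tendsto_mul_ewensMass hθ).inv_tendsto_atTop.const_mul (ewensMass θ i)
    have h2 : ∃ c, Tendsto (fun n => q n i) atTop (𝓝 c) := by
      simp only [hq]
      split_ifs
      · exact ⟨1, tendsto_const_nhds⟩
      · exact ⟨_, ((hac.div_const (a i)).const_sub 1).abs⟩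
    obtain ⟨c, hc⟩ := h2
    simpa using h1.mul hc
  have hev2 := hsmall.eventually (gt_mem_nhds (show (0 : ℝ) < ε / 2 by positivity))
  obtain ⟨N₁, hN₁⟩ := eventually_atTop.1 hev2
  refine ⟨max N N₁, fun n hn => ?_⟩
  have hnN : N ≤ n := (le_max_left _ _).trans hn
  have hn0 : 0 < n := by omega
  have hn' : (0 : ℝ) < n := by exact_mod_cast hn0
  have hs := hN₁ n ((le_max_right _ _).trans hn)
  have hpn := hp n
  have hnonneg : 0 ≤ massError θ n :=
    mul_nonneg (by positivity) (Finset.sum_nonneg fun _ _ => abs_nonneg _)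
  rw [Real.dist_eq, sub_zero, abs_of_nonneg hnonneg]
  have e1 : massError θ n =
      ∑ i ∈ Finset.range n, ewensMass θ i * ((n : ℝ) * ewensMass θ n)⁻¹ * q n i := by
    unfold massError
    rw [Finset.mul_sum]
    refine Finset.sum_congr rfl fun i _ => ?_
    rw [hterm n i hn0]
    field_simp
  have e2 : ∑ i ∈ Finset.Ico N n, ewensMass θ i * ((n : ℝ) * ewensMass θ n)⁻¹ * q n i ≤ ε / 4 := by
    calc ∑ i ∈ Finset.Ico N n, ewensMass θ i * ((n : ℝ) * ewensMass θ n)⁻¹ * q n i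
        ≤ ∑ i ∈ Finset.Ico N n, ewensMass θ i * ((n : ℝ) * ewensMass θ n)⁻¹ * (ε * θ / 4) := by
          refine Finset.sum_le_sum fun i hi => mul_le_mul_of_nonneg_left ?_ ?_
          · rw [Finset.mem_Ico] at hi
            simp only [hq]
            rw [if_neg (by omega)]
            exact (hN₀ n (by omega) i (by omega)).le
          · have := hp i
            positivity
      _ ≤ ∑ i ∈ Finset.range n, ewensMass θ i * ((n : ℝ) * ewensMass θ n)⁻¹ * (ε * θ / 4) := by
          refine Finset.sum_le_sum_of_subset_of_nonneg (fun i hi => ?_) fun i _ _ => ?_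
          · rw [Finset.mem_Ico] at hi
            exact Finset.mem_range.2 hi.2
          · have := hp i
            positivity
      _ = (θ * ∑ i ∈ Finset.range n, ewensMass θ i) * ((n : ℝ) * ewensMass θ n)⁻¹ * (ε / 4) := by
          rw [← Finset.sum_mul, ← Finset.sum_mul]
          ring
      _ = ε / 4 := by
          rw [sum_range_ewensMass]
          field_simp
  rw [e1, ← Finset.sum_range_add_sum_Ico _ hnN]
  linarith

end asymptotics

/-! ### Normalised expectations -/

noncomputable section

/-- The Ewens expectation of a function of the cycle lengths. -/
def ewensMean (θ : ℝ) (n : ℕ) (f : Multiset ℕ → ℝ) : ℝ := ewensSum θ n f / ewensMass θ n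

/-- The indicator function of `{w | w < k}`. -/
def ltInd (k w : ℕ) : ℝ := if w < k then 1 else 0

/-- The elements `i` of `J` with `i ≤ n / L`. -/
def shortPart (L n : ℕ) (J : Finset ℕ) : Finset ℕ :=
  J.filter fun i : ℕ => (i : ℝ) ≤ (n : ℝ) / (L : ℝ)

/-- The elements `i` of `J` with `n / L < i < n`. -/
def longPart (L n : ℕ) (J : Finset ℕ) : Finset ℕ :=
  J.filter fun i : ℕ => (n : ℝ) / (L : ℝ) < (i : ℝ) ∧ i < n

end

section mean

variable {θ : ℝ} {n : ℕ}

theorem ewensMean_mono (hθ : 0 < θ) {f g : Multiset ℕ → ℝ}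
    (h : ∀ l : n.Partition, f l.parts ≤ g l.parts) : ewensMean θ n f ≤ ewensMean θ n g :=
  div_le_div_of_nonneg_right (ewensSum_mono hθ h) (ewensMass_pos hθ n).le

theorem ewensMean_congr {f g : Multiset ℕ → ℝ}
    (h : ∀ l : n.Partition, f l.parts = g l.parts) : ewensMean θ n f = ewensMean θ n g := by
  unfold ewensMean; rw [ewensSum_congr h]

theorem ewensMean_add (f g : Multiset ℕ → ℝ) :
    ewensMean θ n (fun m => f m + g m) = ewensMean θ n f + ewensMean θ n g := by
  unfold ewensMean; rw [ewensSum_add, add_div]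

theorem ewensMean_sub (f g : Multiset ℕ → ℝ) :
    ewensMean θ n (fun m => f m - g m) = ewensMean θ n f - ewensMean θ n g := by
  unfold ewensMean; rw [ewensSum_sub, sub_div]

theorem ewensMean_const_mul (c : ℝ) (f : Multiset ℕ → ℝ) :
    ewensMean θ n (fun m => c * f m) = c * ewensMean θ n f := by
  unfold ewensMean; rw [ewensSum_const_mul, mul_div_assoc]

theorem ewensMean_sum {ι : Type*} (S : Finset ι) (f : ι → Multiset ℕ → ℝ) :
    ewensMean θ n (fun m => ∑ i ∈ S, f i m) = ∑ i ∈ S, ewensMean θ n (f i) := by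
  unfold ewensMean; rw [ewensSum_sum, Finset.sum_div]

theorem ewensMean_one (hθ : 0 < θ) : ewensMean θ n (fun _ => 1) = 1 := by
  unfold ewensMean; rw [ewensSum_one hθ, div_self (ewensMass_pos hθ n).ne']

theorem abs_ewensMean_sub_le (hθ : 0 < θ) {f g h : Multiset ℕ → ℝ}
    (H : ∀ l : n.Partition, |f l.parts - g l.parts| ≤ h l.parts) :
    |ewensMean θ n f - ewensMean θ n g| ≤ ewensMean θ n h := by
  have h1 : ewensMean θ n f ≤ ewensMean θ n (fun m => g m + h m) :=
    ewensMean_mono hθ fun l => by have := (abs_le.1 (H l)).2; linarith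
  have h2 : ewensMean θ n g ≤ ewensMean θ n (fun m => f m + h m) :=
    ewensMean_mono hθ fun l => by have := (abs_le.1 (H l)).1; linarith
  rw [ewensMean_add] at h1 h2
  rw [abs_le]
  constructor <;> linarith

end mean

theorem cast_lt_iff_ltInd (x : ℝ) (w : ℕ) :
    ltInd ⌈x⌉₊ w = if (w : ℝ) < x then 1 else 0 :=
  if_congr Nat.lt_ceil rfl rfl

theorem cycleDF_eq (θ : ℝ) (n : ℕ) (J : Finset ℕ) (x : ℝ) :
    cycleDF θ n J x = ewensMean θ n (fun m => ltInd ⌈x⌉₊ (partsIn J m)) := by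
  refine (ewensProb_eq θ n {m | (partsIn J m : ℝ) < x}).trans (ewensMean_congr fun l => ?_)
  rw [cast_lt_iff_ltInd, Set.indicator_apply]
  rfl

/-- Truncation at M: for L ≤ w ≤ M use the bound M^L; for w > M the extra factor w - L of the next
falling factorial exceeds M - L. -/
theorem descFactorial_le_tail {M : ℝ} {L : ℕ} (hM : (L : ℝ) < M) (w : ℕ) :
    (w.descFactorial L : ℝ) ≤
      M ^ L * (1 - ltInd L w) + 1 / (M - L) * (w.descFactorial (L + 1) : ℝ) := by
  have hM' : 0 < M - L := sub_pos.2 hM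
  have hM0 : 0 < M := (Nat.cast_nonneg L).trans_lt hM
  unfold ltInd
  split_ifs with hw
  · rw [Nat.descFactorial_eq_zero_iff_lt.2 hw, Nat.descFactorial_eq_zero_iff_lt.2 (by omega)]
    simp
  · push Not at hw
    rw [sub_zero, mul_one]
    rcases le_or_gt (w : ℝ) M with h | h
    · have h1 : (w.descFactorial L : ℝ) ≤ (w : ℝ) ^ L := by
        exact_mod_cast Nat.descFactorial_le_pow w L
      have h2 : (w : ℝ) ^ L ≤ M ^ L := pow_le_pow_left₀ (Nat.cast_nonneg w) h L
      have h3 : 0 ≤ 1 / (M - L) * (w.descFactorial (L + 1) : ℝ) := by positivity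
      linarith
    · rw [Nat.descFactorial_succ, Nat.cast_mul, Nat.cast_sub hw]
      have h1 : (M - L) * (w.descFactorial L : ℝ) ≤ ((w : ℝ) - L) * (w.descFactorial L : ℝ) := by
        gcongr
      have h2 : (w.descFactorial L : ℝ) ≤
          1 / (M - L) * (((w : ℝ) - L) * (w.descFactorial L : ℝ)) := by
        rw [div_mul_eq_mul_div, one_mul, le_div_iff₀ hM']
        linarith
      have h3 : 0 ≤ M ^ L := by positivity
      linarith

/-! ### Probability bounds for short cycles and the n-cycle -/

section bounds

variable {θ : ℝ} {S : Finset ℕ}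

/-- A lower bound for the probability of at least `L` cycles with lengths in `S`. -/
theorem pow_le_tail (hθ : 0 < θ) (hθ1 : θ ≤ 1) {b L n : ℕ} (hS : ∀ j ∈ S, 0 < j)
    (hSb : ∀ j ∈ S, j ≤ b) (hn : L * b ≤ n) {u : ℝ} (hu : u = θ * ∑ j ∈ S, 1 / (j : ℝ)) :
    u ^ L ≤ 2 * ((2 * u + (L + 2)) ^ L *
      ewensMean θ n (fun m => 1 - ltInd L (partsIn S m))) := by
  have hp := ewensMass_pos hθ n
  have hu0 : 0 ≤ u := by
    rw [hu]; exact mul_nonneg hθ.le (Finset.sum_nonneg fun _ _ => by positivity)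
  -- Chosen so that M - L = 2(u+1): the term with the (L+1)-st moment is then at most half the L-th
  -- moment and is absorbed.
  set M : ℝ := 2 * u + (L + 2) with hM
  have hML : (L : ℝ) < M := by linarith
  set E : ℕ → ℝ := fun l => ewensMean θ n (fun m => ((partsIn S m).descFactorial l : ℝ)) with hE
  have hEl : ∀ l, E l = θ ^ l * convIter S l (ewensMass θ) n / ewensMass θ n := fun l => by
    simp only [hE]
    rw [ewensMean, ewensSum_descFactorial hθ hS]
  have h1 : E L ≤ M ^ L * ewensMean θ n (fun m => 1 - ltInd L (partsIn S m)) +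
      1 / (M - L) * E (L + 1) := by
    simp only [hE]
    rw [← ewensMean_const_mul, ← ewensMean_const_mul, ← ewensMean_add]
    exact ewensMean_mono hθ fun l => descFactorial_le_tail hML _
  have h2 : E (L + 1) ≤ (u + 1) * E L := by
    rw [hEl, hEl, ← mul_div_assoc]
    refine div_le_div_of_nonneg_right ?_ hp.le
    have := convIter_succ_le (convIter_one_ewensMass_le hθ hS) L n
    calc θ ^ (L + 1) * convIter S (L + 1) (ewensMass θ) n
        ≤ θ ^ (L + 1) * ((∑ j ∈ S, 1 / (j : ℝ) + 1 / θ) * convIter S L (ewensMass θ) n) := by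
          gcongr
      _ = _ := by
          rw [hu, pow_succ]
          field_simp
  have h3 : u ^ L ≤ E L := by
    rw [hEl, le_div_iff₀ hp, hu, mul_pow, mul_assoc]
    gcongr
    exact pow_mul_ewensMass_le_convIter hθ hθ1 hSb L n hn
  have h4 : 1 / (M - L) * E (L + 1) ≤ 1 / 2 * E L := by
    have h5 : M - L = 2 * (u + 1) := by rw [hM]; ring
    rw [h5]
    calc 1 / (2 * (u + 1)) * E (L + 1) ≤ 1 / (2 * (u + 1)) * ((u + 1) * E L) := by gcongr
      _ = 1 / 2 * E L := by field_simp
  linarith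

/-- From 2j ≤ n and the monotonicity of k p(k) it follows that p(n-j) ≤ 2p(n). -/
theorem ewensMean_partsIn_le (hθ : 0 < θ) {n : ℕ} (hS : ∀ j ∈ S, 0 < j ∧ 2 * j ≤ n) :
    ewensMean θ n (fun m => (partsIn S m : ℝ)) ≤ 2 * θ * ∑ j ∈ S, 1 / (j : ℝ) := by
  have hp := ewensMass_pos hθ
  have h := ewensSum_descFactorial hθ (fun j hj => (hS j hj).1) 1 n
  simp only [Nat.descFactorial_one, pow_one] at h
  rw [ewensMean, h, div_le_iff₀ (hp n)]
  have h1 : convIter S 1 (ewensMass θ) n ≤ ∑ j ∈ S, 1 / (j : ℝ) * (2 * ewensMass θ n) := by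
    refine (Finset.sum_le_sum fun j hj => mul_le_mul_of_nonneg_left ?_ (by positivity)).trans
      (Finset.sum_le_sum_of_subset_of_nonneg (Finset.filter_subset _ _) fun j _ _ => ?_)
    · rw [Finset.mem_filter] at hj
      obtain ⟨hj0, hj2⟩ := hS j hj.1
      have h2 : ((n - j : ℕ) : ℝ) * ewensMass θ (n - j) ≤ n * ewensMass θ n :=
        mul_ewensMass_mono hθ (Nat.sub_le n j)
      have h3 : (n : ℝ) ≤ 2 * (n - j : ℕ) := by
        have : n ≤ 2 * (n - j) := by omega
        exact_mod_cast this
      have h4 : (0 : ℝ) < (n - j : ℕ) := by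
        have : 0 < n - j := by omega
        exact_mod_cast this
      refine le_of_mul_le_mul_left ?_ h4
      have := mul_le_mul_of_nonneg_right h3 (hp n).le
      simp only [convIter]
      linarith
    · have := hp n
      positivity
  rw [← Finset.sum_mul] at h1
  have := mul_le_mul_of_nonneg_left h1 hθ.le
  linarith

theorem ewensMean_count_self (hθ : 0 < θ) {n : ℕ} (hn : 0 < n) :
    ewensMean θ n (fun m => (m.count n : ℝ)) = θ * ((n : ℝ) * ewensMass θ n)⁻¹ := by
  have h := ewensSum_count_mul θ hn (n := n) (fun _ => 1)
  simp only [mul_one, le_refl, if_true, Nat.sub_self] at h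
  rw [ewensMean, h, ewensSum_one hθ, ewensMass_zero]
  have := ewensMass_pos hθ n
  field_simp

end bounds

/-! ### Short and long cycles -/

section parts

variable {L n : ℕ} {J : Finset ℕ}

theorem mem_shortPart (hL : 0 < L) {j : ℕ} : j ∈ shortPart L n J ↔ j ∈ J ∧ L * j ≤ n := by
  have hL' : (0 : ℝ) < L := by exact_mod_cast hL
  rw [shortPart, Finset.mem_filter, le_div_iff₀ hL', mul_comm]
  norm_cast

theorem mem_longPart (hL : 0 < L) {j : ℕ} :
    j ∈ longPart L n J ↔ j ∈ J ∧ n < L * j ∧ j < n := by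
  have hL' : (0 : ℝ) < L := by exact_mod_cast hL
  rw [longPart, Finset.mem_filter, div_lt_iff₀ hL', mul_comm]
  norm_cast

/-- A partition of `n` has fewer than `L` parts exceeding `n / L`. -/
theorem partsIn_longPart_lt (hL : 0 < L) (l : n.Partition) :
    partsIn (longPart L n J) l.parts < L := by
  by_contra! h
  have h1 : ∑ j ∈ longPart L n J, l.parts.count j * j ≤ n := by
    conv_rhs => rw [← l.parts_sum, Finset.sum_multiset_count]
    rw [← Finset.sum_filter_of_ne (p := fun j => j ∈ l.parts.toFinset) fun j _ hj => ?_]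
    · simp only [smul_eq_mul]
      exact Finset.sum_le_sum_of_subset fun j hj => (Finset.mem_filter.1 hj).2
    · rw [Multiset.mem_toFinset]
      by_contra h0
      simp [Multiset.count_eq_zero_of_notMem h0] at hj
  have h2 : (n + 1) * partsIn (longPart L n J) l.parts ≤
      L * ∑ j ∈ longPart L n J, l.parts.count j * j := by
    rw [partsIn, Finset.mul_sum, Finset.mul_sum]
    refine Finset.sum_le_sum fun j hj => ?_
    have := ((mem_longPart hL).1 hj).2.1
    calc (n + 1) * l.parts.count j ≤ L * j * l.parts.count j := Nat.mul_le_mul_right _ this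
      _ = _ := by ring
  have h3 := Nat.mul_le_mul_left (n + 1) h
  have h4 := Nat.mul_le_mul_left L h1
  nlinarith

/-- The length n is neither short nor long. If no short part and no part n occurs, the two counts
agree; otherwise the right side is at least 1. -/
theorem abs_ltInd_sub_le (hL : 0 < L) (hJ : J ⊆ Finset.Icc 1 n) (k : ℕ) (m : Multiset ℕ) :
    |ltInd k (partsIn J m) - ltInd k (partsIn (longPart L n J) m)| ≤
      (partsIn (shortPart L n J) m : ℝ) + m.count n := by
  rcases Nat.eq_zero_or_pos (partsIn (shortPart L n J) m + m.count n) with h | h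
  · have h1 : partsIn J m = partsIn (longPart L n J) m := by
      refine (Finset.sum_subset (Finset.filter_subset _ _) fun j hj hj' => ?_).symm
      have h2 : ∑ j ∈ shortPart L n J, m.count j = 0 := by unfold partsIn at h; omega
      have h3 := mt (mem_longPart hL).2 hj'
      by_cases h4 : L * j ≤ n
      · exact Finset.sum_eq_zero_iff.1 h2 j ((mem_shortPart hL).2 ⟨hj, h4⟩)
      · have h5 : j = n := by
          have := (Finset.mem_Icc.1 (hJ hj)).2
          by_contra h6
          exact h3 ⟨hj, by omega, by omega⟩
        rw [h5]; omega
    rw [h1, sub_self, abs_zero]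
    positivity
  · have h1 : (1 : ℝ) ≤ (partsIn (shortPart L n J) m : ℝ) + m.count n := by exact_mod_cast h
    refine le_trans ?_ h1
    unfold ltInd
    split_ifs <;> simp

theorem shortCycleWeight_eq : shortCycleWeight L n J = ∑ j ∈ shortPart L n J, 1 / (j : ℝ) := rfl

theorem longCycleMoment_eq {θ : ℝ} (hn : 0 < n) (l : ℕ) :
    longCycleMoment θ L n J l = θ ^ l * convIter (longPart L n J) l (powDensity θ n) n := by
  rw [longCycleMoment, convIter_eq_sum]
  congr 1
  refine Finset.sum_congr rfl fun j _ => ?_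
  have hn' : (n : ℝ) ≠ 0 := by positivity
  rcases lt_trichotomy (∑ i, j i) n with h | h | h
  · rw [if_pos h, if_pos h.le, powDensity, if_neg (by omega), Nat.cast_sub h.le, sub_div,
      div_self hn']
    push_cast
    rfl
  -- Tuples of sum exactly n enter the convolution but not the moment; the value 0 of `powDensity`
  -- at 0 removes them.
  · rw [if_neg h.not_lt, if_pos h.le, h, Nat.sub_self, powDensity, if_pos rfl, mul_zero]
  · rw [if_neg (by omega), if_neg (by omega)]

/-- The factorial moments of the number of long cycles are close to `longCycleMoment`. -/
theorem abs_moment_sub_longCycleMoment_le {θ : ℝ} (hθ : 0 < θ) (hL : 0 < L) (hn : 0 < n)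
    (hJ : J ⊆ Finset.Icc 1 n) (l : ℕ) :
    |ewensMean θ n (fun m => ((partsIn (longPart L n J) m).descFactorial (l + 1) : ℝ)) -
      longCycleMoment θ L n J (l + 1)| ≤ (θ * L) ^ (l + 1) * massError θ n := by
  have hpos : ∀ j ∈ longPart L n J, 0 < j := fun j hj =>
    (Finset.mem_Icc.1 (hJ ((mem_longPart hL).1 hj).1)).1
  have hcard : (longPart L n J).card ≤ n := by
    have := Finset.card_le_card ((Finset.filter_subset _ _ : longPart L n J ⊆ J).trans hJ)
    rwa [Nat.card_Icc, Nat.add_sub_cancel] at this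
  rw [ewensMean, ewensSum_descFactorial hθ hpos, longCycleMoment_eq hn, mul_div_assoc,
    ← convIter_div, ← mul_sub, abs_mul, abs_of_nonneg (by positivity : 0 ≤ θ ^ (l + 1)), mul_pow,
    mul_assoc]
  refine mul_le_mul_of_nonneg_left ((abs_convIter_sub_le _ _ _ _).trans
    ((convIter_le_sum_range (fun _ => abs_nonneg _) hn
      (fun j hj => ((mem_longPart hL).1 hj).2.1.le) hcard l n).trans (le_of_eq ?_)))
    (by positivity)
  unfold massError
  ring

end parts

/-! ### Two bases for functions on {0, …, L-1} -/

/-- Functions on `{0, …, L - 1}` are linear combinations of falling factorials. -/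
theorem exists_eq_sum_descFactorial (L : ℕ) (f : ℕ → ℝ) :
    ∃ c : ℕ → ℝ, ∀ x < L, f x = ∑ l ∈ Finset.range L, c l * (x.descFactorial l : ℝ) := by
  induction L with
  | zero => exact ⟨0, fun x hx => by omega⟩
  | succ L ih =>
    obtain ⟨c, hc⟩ := ih
    set r := ∑ l ∈ Finset.range L, c l * (L.descFactorial l : ℝ)
    refine ⟨fun l => if l = L then (f L - r) / L ! else c l, fun x hx => ?_⟩
    have h1 : ∑ l ∈ Finset.range L, (if l = L then (f L - r) / L ! else c l) *
        (x.descFactorial l : ℝ) = ∑ l ∈ Finset.range L, c l * (x.descFactorial l : ℝ) :=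
      Finset.sum_congr rfl fun l hl => by
        rw [if_neg (Finset.mem_range.1 hl).ne]
    rw [Finset.sum_range_succ, h1]
    simp only [if_true]
    rcases Nat.lt_succ_iff_lt_or_eq.1 hx with h | rfl
    · rw [Nat.descFactorial_eq_zero_iff_lt.2 h, Nat.cast_zero, mul_zero, add_zero, hc x h]
    · rw [Nat.descFactorial_self, div_mul_cancel₀ _ (by positivity)]
      ring

/-- Functions on `{0, …, L - 1}` are linear combinations of indicators of initial segments. -/
theorem exists_eq_sum_ltInd (L : ℕ) (f : ℕ → ℝ) :
    ∃ c : ℕ → ℝ, ∀ x < L, f x = ∑ k ∈ Finset.range L, c k * ltInd (k + 1) x := by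
  induction L generalizing f with
  | zero => exact ⟨0, fun x hx => by omega⟩
  | succ L ih =>
    obtain ⟨c, hc⟩ := ih fun x => f x - f L
    refine ⟨fun k => if k = L then f L else c k, fun x hx => ?_⟩
    have h1 : ∑ k ∈ Finset.range L, (if k = L then f L else c k) * ltInd (k + 1) x =
        ∑ k ∈ Finset.range L, c k * ltInd (k + 1) x :=
      Finset.sum_congr rfl fun k hk => by
        rw [if_neg (Finset.mem_range.1 hk).ne]
    rw [Finset.sum_range_succ, h1]
    simp only [if_true]
    have h2 : ltInd (L + 1) x = 1 := if_pos hx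
    rw [h2, mul_one]
    rcases Nat.lt_succ_iff_lt_or_eq.1 hx with h | rfl
    · rw [← hc x h]; ring
    · rw [Finset.sum_eq_zero, zero_add]
      intro k hk
      rw [ltInd, if_neg (by have := Finset.mem_range.1 hk; omega), mul_zero]

/-! ### The limit variable and weak convergence -/

section integrals

variable {Ω : Type*} [MeasurableSpace Ω] {P : Measure Ω} {Y : Ω → ℕ} {L : ℕ}

theorem integrable_comp_of_lt [IsProbabilityMeasure P] (hY : Measurable Y) (hYL : ∀ᵐ ω ∂P, Y ω < L) (f : ℕ → ℝ) :
    Integrable (fun ω => f (Y ω)) P := by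
  refine Integrable.of_bound ((Measurable.of_discrete (f := f)).comp hY).aestronglyMeasurable
    (∑ x ∈ Finset.range L, |f x|) ?_
  filter_upwards [hYL] with ω hω
  exact Finset.single_le_sum (f := fun x => |f x|) (fun _ _ => abs_nonneg _)
    (Finset.mem_range.2 hω)

theorem integral_eq_sum_of_lt [IsProbabilityMeasure P] (hY : Measurable Y)
    (hYL : ∀ᵐ ω ∂P, Y ω < L) {f : ℕ → ℝ}
    {c : ℕ → ℝ} {g : ℕ → ℕ → ℝ} (h : ∀ x < L, f x = ∑ l ∈ Finset.range L, c l * g l x) :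
    ∫ ω, f (Y ω) ∂P = ∑ l ∈ Finset.range L, c l * ∫ ω, g l (Y ω) ∂P := by
  have h1 : ∫ ω, f (Y ω) ∂P = ∫ ω, ∑ l ∈ Finset.range L, c l * g l (Y ω) ∂P :=
    integral_congr_ae (by filter_upwards [hYL] with ω hω using h _ hω)
  rw [h1, integral_finsetSum _ fun l _ =>
    integrable_comp_of_lt hY hYL fun x => c l * g l x]
  simp_rw [integral_const_mul]

theorem distFun_eq (hY : Measurable Y) (x : ℝ) :
    distFun P Y x = ∫ ω, ltInd ⌈x⌉₊ (Y ω) ∂P := by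
  have hm : MeasurableSet {ω | (Y ω : ℝ) < x} :=
    measurableSet_lt (measurable_from_nat.comp hY) measurable_const
  simp_rw [cast_lt_iff_ltInd]
  rw [distFun, ← integral_indicator_one hm]
  rfl

variable {θ : ℝ} {J : ℕ → Finset ℕ}

theorem weakConv_of_tendsto (hY : Measurable Y)
    (h : ∀ k, Tendsto (fun n => ewensMean θ n fun m => ltInd k (partsIn (J n) m)) atTop
      (𝓝 (∫ ω, ltInd k (Y ω) ∂P))) :
    WeakConv (fun n => cycleDF θ n (J n)) (distFun P Y) := by
  intro x _
  simp only [cycleDF_eq, distFun_eq hY]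
  exact h _

/-- The limit is constant on (k, k+1), so k + 1/2 is a continuity point. -/
theorem tendsto_of_weakConv (hY : Measurable Y)
    (h : WeakConv (fun n => cycleDF θ n (J n)) (distFun P Y)) (k : ℕ) :
    Tendsto (fun n => ewensMean θ n fun m => ltInd (k + 1) (partsIn (J n) m)) atTop
      (𝓝 (∫ ω, ltInd (k + 1) (Y ω) ∂P)) := by
  have hceil : ∀ x ∈ Set.Ioo (k : ℝ) (k + 1), ⌈x⌉₊ = k + 1 := fun x hx => by
    rw [Nat.ceil_eq_iff (Nat.succ_ne_zero k)]
    push_cast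
    simpa using ⟨hx.1, hx.2.le⟩
  have hmem : (k : ℝ) + 1 / 2 ∈ Set.Ioo (k : ℝ) (k + 1) := by
    constructor <;> linarith
  have hcont : ContinuousAt (distFun P Y) (k + 1 / 2) := by
    refine continuousAt_const.congr (f := fun _ => ∫ ω, ltInd (k + 1) (Y ω) ∂P) ?_
    filter_upwards [Ioo_mem_nhds hmem.1 hmem.2] with x hx
    rw [distFun_eq hY, hceil x hx]
  have := h _ hcont
  simpa only [cycleDF_eq, distFun_eq hY, hceil _ hmem] using this

end integrals

/-- No bound on u is known beforehand. The ratio y = u/(2u+K) satisfies y^L ≤ 2v, hence y → 0, and u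
= Ky/(1-2y) is recovered from it. -/
theorem tendsto_zero_of_pow_le {u v : ℕ → ℝ} {K : ℝ} (hK : 0 < K) {L : ℕ} (hL : L ≠ 0)
    (hu : ∀ n, 0 ≤ u n) (h : ∀ n, u n ^ L ≤ 2 * ((2 * u n + K) ^ L * v n))
    (hv : Tendsto v atTop (𝓝 0)) : Tendsto u atTop (𝓝 0) := by
  set y : ℕ → ℝ := fun n => u n / (2 * u n + K) with hy
  have hpos : ∀ n, 0 < 2 * u n + K := fun n => by have := hu n; positivity
  have hy0 : ∀ n, 0 ≤ y n := fun n => div_nonneg (hu n) (hpos n).le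
  have h1 : Tendsto (fun n => y n ^ L) atTop (𝓝 0) := by
    refine squeeze_zero (fun n => pow_nonneg (hy0 n) L) (fun n => ?_) (by simpa using hv.const_mul 2)
    rw [hy, div_pow, div_le_iff₀ (pow_pos (hpos n) L)]
    linarith [h n]
  have h2 : Tendsto y atTop (𝓝 0) := by
    have h3 := h1.rpow_const (p := (L : ℝ)⁻¹) (Or.inr (by positivity))
    rw [Real.zero_rpow (by positivity)] at h3
    exact h3.congr fun n => Real.pow_rpow_inv_natCast (hy0 n) hL
  have h4 : Tendsto (fun n => K * y n / (1 - 2 * y n)) atTop (𝓝 0) := by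
    have h3 : Tendsto (fun n => 1 - 2 * y n) atTop (𝓝 1) := by
      simpa using (h2.const_mul 2).const_sub 1
    have h5 := (h2.const_mul K).div h3 one_ne_zero
    rw [mul_zero, zero_div] at h5
    exact h5
  refine h4.congr fun n => ?_
  have h5 := (hpos n).ne'
  have h6 : 1 - 2 * y n = K / (2 * u n + K) := by
    simp only [hy]; field_simp; ring
  rw [h6, mul_div_assoc, div_div_div_cancel_right₀ h5, mul_div_cancel₀ _ hK.ne']

/-! ### Limits for short and long cycles -/

section limits

variable {θ : ℝ} {J : ℕ → Finset ℕ} {L : ℕ}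

theorem tendsto_shortCycleWeight (hθ : 0 < θ) (hθ1 : θ ≤ 1) (hJ : ∀ n, J n ⊆ Finset.Icc 1 n)
    (hL : 0 < L)
    (h : Tendsto (fun n => ewensMean θ n fun m => 1 - ltInd L (partsIn (J n) m)) atTop (𝓝 0)) :
    Tendsto (fun n => shortCycleWeight L n (J n)) atTop (𝓝 0) := by
  have h1 : Tendsto (fun n => θ * shortCycleWeight L n (J n)) atTop (𝓝 0) := by
    refine tendsto_zero_of_pow_le (K := L + 2) (by positivity) hL.ne'
      (fun n => mul_nonneg hθ.le (Finset.sum_nonneg fun _ _ => by positivity)) (fun n => ?_) h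
    have hs : ∀ j ∈ shortPart L n (J n), 0 < j := fun j hj =>
      (Finset.mem_Icc.1 (hJ n ((mem_shortPart hL).1 hj).1)).1
    -- With b the integer part of n/L, any L short cycle lengths sum to at most n.
    refine (pow_le_tail hθ hθ1 (b := n / L) (n := n) hs (fun j hj => ?_)
      (Nat.mul_div_le n L) rfl).trans ?_
    · rw [Nat.le_div_iff_mul_le hL, mul_comm]
      exact ((mem_shortPart hL).1 hj).2
    · rw [shortCycleWeight_eq]
      have hH : 0 ≤ ∑ j ∈ shortPart L n (J n), 1 / (j : ℝ) :=
        Finset.sum_nonneg fun _ _ => by positivity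
      refine mul_le_mul_of_nonneg_left (mul_le_mul_of_nonneg_left
        (ewensMean_mono hθ fun l => ?_) (by positivity)) zero_le_two
      have h2 : partsIn (shortPart L n (J n)) l.parts ≤ partsIn (J n) l.parts :=
        Finset.sum_le_sum_of_subset (Finset.filter_subset _ _)
      unfold ltInd
      split_ifs <;> first | omega | norm_num
  have h2 := h1.const_mul θ⁻¹
  rw [mul_zero] at h2
  exact h2.congr fun n => by rw [inv_mul_cancel_left₀ hθ.ne']

theorem tendsto_ltInd_sub (hθ : 0 < θ) (hJ : ∀ n, J n ⊆ Finset.Icc 1 n) (hL : 2 ≤ L)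
    (h : Tendsto (fun n => shortCycleWeight L n (J n)) atTop (𝓝 0)) (k : ℕ) :
    Tendsto (fun n => ewensMean θ n (fun m => ltInd k (partsIn (J n) m)) -
      ewensMean θ n (fun m => ltInd k (partsIn (longPart L n (J n)) m))) atTop (𝓝 0) := by
  have hL0 : 0 < L := by omega
  have h1 : Tendsto (fun n : ℕ => 2 * θ * shortCycleWeight L n (J n) +
      θ * ((n : ℝ) * ewensMass θ n)⁻¹) atTop (𝓝 0) := by
    simpa using (h.const_mul (2 * θ)).add
      ((tendsto_mul_ewensMass hθ).inv_tendsto_atTop.const_mul θ)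
  refine squeeze_zero_norm' ?_ h1
  filter_upwards [eventually_gt_atTop 0] with n hn
  rw [Real.norm_eq_abs, ← ewensMean_count_self hθ hn]
  refine (abs_ewensMean_sub_le hθ (h := fun m =>
    (partsIn (shortPart L n (J n)) m : ℝ) + m.count n) fun l => abs_ltInd_sub_le hL0 (hJ n) k l.parts).trans ?_
  rw [ewensMean_add, shortCycleWeight_eq]
  refine add_le_add_left (ewensMean_partsIn_le hθ fun j hj => ?_) _
  have hj' := (mem_shortPart hL0).1 hj
  refine ⟨(Finset.mem_Icc.1 (hJ n hj'.1)).1, le_trans (Nat.mul_le_mul_right j hL) hj'.2⟩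

theorem tendsto_moment_sub (hθ : 0 < θ) (hJ : ∀ n, J n ⊆ Finset.Icc 1 n) (hL : 0 < L) (l : ℕ) :
    Tendsto (fun n =>
      ewensMean θ n (fun m => ((partsIn (longPart L n (J n)) m).descFactorial (l + 1) : ℝ)) -
        longCycleMoment θ L n (J n) (l + 1)) atTop (𝓝 0) := by
  refine squeeze_zero_norm' ?_ (by simpa using (tendsto_massError hθ).const_mul ((θ * L) ^ (l + 1)))
  filter_upwards [eventually_gt_atTop 0] with n hn
  exact abs_moment_sub_longCycleMoment_le hθ hL hn (hJ n) l

variable {Ω : Type*} [MeasurableSpace Ω] {P : Measure Ω} [IsProbabilityMeasure P] {Y : Ω → ℕ}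

/-- Limits of expectations of a spanning family of functions of the number of long cycles give
limits of expectations of all functions in the span. -/
theorem tendsto_ewensMean_of_eq_sum (hY : Measurable Y) (hYL : ∀ᵐ ω ∂P, Y ω < L) (hL : 0 < L)
    {f : ℕ → ℝ} {c : ℕ → ℝ} {g : ℕ → ℕ → ℝ}
    (h : ∀ x < L, f x = ∑ l ∈ Finset.range L, c l * g l x)
    (hg : ∀ l < L, Tendsto (fun n => ewensMean θ n fun m => g l (partsIn (longPart L n (J n)) m))
      atTop (𝓝 (∫ ω, g l (Y ω) ∂P))) :
    Tendsto (fun n => ewensMean θ n fun m => f (partsIn (longPart L n (J n)) m)) atTop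
      (𝓝 (∫ ω, f (Y ω) ∂P)) := by
  rw [integral_eq_sum_of_lt hY hYL h]
  have h1 : ∀ n, ewensMean θ n (fun m => f (partsIn (longPart L n (J n)) m)) =
      ∑ l ∈ Finset.range L,
        c l * ewensMean θ n (fun m => g l (partsIn (longPart L n (J n)) m)) := fun n => by
    simp_rw [← ewensMean_const_mul]
    rw [← ewensMean_sum]
    exact ewensMean_congr fun l => h _ (partsIn_longPart_lt hL l)
  simp_rw [h1]
  exact tendsto_finsetSum _ fun l hl => (hg l (Finset.mem_range.1 hl)).const_mul _

end limits

end Ewens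

/-! ### Assembly of both directions -/

open Ewens

theorem corollary5
    (θ : ℝ) (hθ : 0 < θ)
    (J : ℕ → Finset ℕ) (hJ : ∀ n, J n ⊆ Finset.Icc 1 n)
    (L : ℕ) (hL : 2 ≤ L)
    {Ω : Type*} [MeasurableSpace Ω] (P : Measure Ω) [IsProbabilityMeasure P]
    (Y : Ω → ℕ) (hY : Measurable Y) (hYL : ∀ᵐ ω ∂P, Y ω ≤ L - 1)
    (υ : ℕ → ℝ)
    (hυ : ∀ l : ℕ, 1 ≤ l → l ≤ L - 1 → υ l = ∫ ω, ((Y ω).descFactorial l : ℝ) ∂P) :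
    (((∀ l : ℕ, 1 ≤ l → l ≤ L - 1 →
          Tendsto (fun n => Ewens.longCycleMoment θ L n (J n) l) atTop (𝓝 (υ l))) ∧
        Tendsto (fun n => Ewens.shortCycleWeight L n (J n)) atTop (𝓝 0)) →
      Ewens.WeakConv (fun n => Ewens.cycleDF θ n (J n)) (Ewens.distFun P Y)) ∧
    (θ ≤ 1 →
      Ewens.WeakConv (fun n => Ewens.cycleDF θ n (J n)) (Ewens.distFun P Y) →
      (∀ l : ℕ, 1 ≤ l → l ≤ L - 1 →
          Tendsto (fun n => Ewens.longCycleMoment θ L n (J n) l) atTop (𝓝 (υ l))) ∧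
        Tendsto (fun n => Ewens.shortCycleWeight L n (J n)) atTop (𝓝 0)) := by
  have hL0 : 0 < L := by omega
  have hYL' : ∀ᵐ ω ∂P, Y ω < L := by filter_upwards [hYL] with ω hω; omega
  constructor
  · rintro ⟨hmom, hshort⟩
    refine weakConv_of_tendsto hY fun k => ?_
    obtain ⟨c, hc⟩ := exists_eq_sum_descFactorial L (ltInd k)
    have h1 := tendsto_ewensMean_of_eq_sum (θ := θ) (J := J) hY hYL' hL0 hc fun l hl => by
      rcases l with _ | l
      · simp [ewensMean_one hθ]
      · rw [← hυ (l + 1) (by omega) (by omega)]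
        simpa using (tendsto_moment_sub hθ hJ hL0 l).add (hmom (l + 1) (by omega) (by omega))
    simpa using (tendsto_ltInd_sub hθ hJ hL hshort k).add h1
  · intro hθ1 hconv
    have h1 := tendsto_of_weakConv hY hconv
    have hshort : Tendsto (fun n => shortCycleWeight L n (J n)) atTop (𝓝 0) := by
      refine tendsto_shortCycleWeight hθ hθ1 hJ hL0 ?_
      have h2 := (h1 (L - 1)).const_sub 1
      have h3 : ∫ ω, ltInd (L - 1 + 1) (Y ω) ∂P = 1 := by
        rw [Nat.sub_add_cancel hL0]
        have : ∫ ω, ltInd L (Y ω) ∂P = ∫ _, (1 : ℝ) ∂P :=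
          integral_congr_ae (by filter_upwards [hYL'] with ω hω using if_pos hω)
        simpa using this
      rw [h3, sub_self, Nat.sub_add_cancel hL0] at h2
      exact h2.congr fun n => by rw [ewensMean_sub, ewensMean_one hθ]
    refine ⟨fun l hl hlL => ?_, hshort⟩
    -- The forward argument reversed: falling factorials are expanded in indicators, whose limits
    -- for long cycles are available once short cycles are negligible.
    obtain ⟨c, hc⟩ := exists_eq_sum_ltInd L fun x => (x.descFactorial l : ℝ)
    have h2 := tendsto_ewensMean_of_eq_sum (θ := θ) (J := J) hY hYL' hL0 hc fun k _ => by
      simpa using (h1 k).sub (tendsto_ltInd_sub hθ hJ hL hshort (k + 1))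
    obtain ⟨l, rfl⟩ : ∃ r, l = r + 1 := ⟨l - 1, by omega⟩
    rw [hυ _ hl hlL]
    simpa using h2.sub (tendsto_moment_sub hθ hJ hL0 l)
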